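/- Let $d\ge 1$, $\xi>0$, $\lambda>0$. Let $G$ be a probability measure on $(0,\infty)$ whose tail function $\bar G(u)=G((u,\infty))$ is regularly varying at infinity with exponent $-\xi$, i.e. $\bar G(tx)/\bar G(x)\to t^{-\xi}$ as $x\to\infty$ for every $t>0$. Let $h:\mathbb R^d\to[0,\infty]$ be measurable, not identically zero, and suppose that there are $\gamma>d/\xi$ and $C>0$ with $$h(x)\le C\,(|x|^{-\gamma}\wedge 1),\qquad x\in\mathbb R^d$$ (with $|0|^{-\gamma}=+\infty$), where $|\cdot|$ is the Euclidean norm. Let $\Phi_\lambda$ be a Poisson point process on $\mathbb R^d\times(0,\infty)$ with intensity measure $\lambda\,dx\,G(dm)$ and let $$M_\lambda(y)=\sup\{m\,h(y-x)\;:\;(x,m)\in\Phi_\lambda\},\qquad y\in\mathbb R^d,$$ be the associated extremal shot noise. Then $\sup_{|y|\le R}M_\lambda(y)$ is almost surely finite for every $R$, and, as $R\to\infty$, $$\frac1{N(R)}\sup_{|y|\le R}M_\lambda(y)\Longrightarrow F_\xi$$ weakly, where $F_\xi$ is the Fréchet law with distribution function $F_\xi(x)=\exp(-x^{-\xi})\mathbf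 1_{\{x>0\}}$ and $$N(R)=\|h\|_\infty\, c_d^{1/\xi}\,\lambda^{1/\xi}\,G^{\leftarrow}(1-R^{-d}),$$ with $\|h\|_\infty=\sup_{x}h(x)$, $c_d$ the volume of the Euclidean unit ball of $\mathbb R^d$, and $G^{\leftarrow}(u)=\inf\{x>0: G((0,x])\ge u\}$, $0<u<1$, the quantile function of $G$. -/

import Mathlib

open MeasureTheory ProbabilityTheory Filter Topology
open scoped ENNReal NNReal

noncomputable section

namespace ShotNoise

/-- `Φ`, a random subset of `X` defined on the probability space `(Ω, P)`, is a (simple) Poisson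
point process with intensity measure `ν`: the points form a locally finite set, the number of points
in every measurable set `A` is a random variable which is Poisson distributed with mean `ν A`
(almost surely infinite if `ν A = ∞`), and the numbers of points in pairwise disjoint measurable
sets are independent. -/
structure IsPoissonPointProcess {Ω X : Type*} [MeasurableSpace Ω] [TopologicalSpace X]
    [MeasurableSpace X] (Φ : Ω → Set X) (ν : Measure X) (P : Measure Ω) : Prop where
  locallyFinite : ∀ ω, ∀ K : Set X, IsCompact K → (Φ ω ∩ K).Finite
  measurable_count : ∀ A : Set X, MeasurableSet A → Measurable fun ω => (Φ ω ∩ A).encard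
  count_law : ∀ A : Set X, MeasurableSet A → ν A ≠ ∞ →
    P.map (fun ω => (Φ ω ∩ A).encard) =
      (poissonMeasure (ν A).toNNReal).map (fun k : ℕ => (k : ℕ∞))
  count_infinite : ∀ A : Set X, MeasurableSet A → ν A = ∞ →
    ∀ᵐ ω ∂P, (Φ ω ∩ A).encard = ⊤
  indep : ∀ (n : ℕ) (A : Fin n → Set X), (∀ i, MeasurableSet (A i)) →
    Pairwise (fun i j => Disjoint (A i) (A j)) →
    iIndepFun (fun i ω => (Φ ω ∩ A i).encard) P

/-- The value at `y` of the extremal shot noise with shape function `h` built on the set `S` of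
marked points `(x, m)`, that is `sup {m * h (y - x) ; (x, m) ∈ S} ∈ [0, ∞]`. -/
def extremalShotNoise {d : ℕ} (h : EuclideanSpace ℝ (Fin d) → ℝ≥0∞)
    (S : Set (EuclideanSpace ℝ (Fin d) × Set.Ioi (0 : ℝ))) (y : EuclideanSpace ℝ (Fin d)) : ℝ≥0∞ :=
  ⨆ φ ∈ S, ENNReal.ofReal (φ.2 : ℝ) * h (y - φ.1)

/-- The tail function `u ↦ G((u, ∞))` of a measure on `(0, ∞)`. -/
def tail (G : Measure (Set.Ioi (0 : ℝ))) (u : ℝ) : ℝ :=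
  G.real {m | u < (m : ℝ)}

/-- The quantile function `u ↦ inf {x > 0 ; G((0, x]) ≥ u}` of a probability on `(0, ∞)`. -/
def quantile (G : Measure (Set.Ioi (0 : ℝ))) (u : ℝ) : ℝ :=
  sInf {x : ℝ | 0 < x ∧ u ≤ G.real {m | (m : ℝ) ≤ x}}

/-- `f` is regularly varying at infinity with exponent `ρ`. -/
structure IsRegularlyVarying (f : ℝ → ℝ) (ρ : ℝ) : Prop where
  measurable : Measurable f
  eventually_pos : ∀ᶠ x in atTop, 0 < f x
  tendsto_ratio : ∀ t : ℝ, 0 < t → Tendsto (fun x => f (t * x) / f x) atTop (𝓝 (t ^ ρ))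

/-- The decay condition: there are `γ > d / ξ` and `C > 0` such that `h x ≤ C (|x| ^ (-γ) ∧ 1)` for
all `x` (with `|0| ^ (-γ) = ∞`). -/
def DecayCondition {d : ℕ} (ξ : ℝ) (h : EuclideanSpace ℝ (Fin d) → ℝ≥0∞) : Prop :=
  ∃ γ C : ℝ, (d : ℝ) / ξ < γ ∧ 0 < C ∧
    ∀ x, h x ≤ ENNReal.ofReal C * min (‖x‖ₑ ^ (-γ)) 1

/-- The normalisation `N(R) = ‖h‖_∞ c_d^{1/ξ} λ^{1/ξ} G^←(1 - R^{-d})`, where `‖h‖_∞` is the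
supremum of `h` and `c_d` is the volume of the unit ball. -/
def normalisation {d : ℕ} (h : EuclideanSpace ℝ (Fin d) → ℝ≥0∞) (G : Measure (Set.Ioi (0 : ℝ)))
    (lam ξ R : ℝ) : ℝ :=
  (⨆ x, h x).toReal *
    (volume.real (Metric.ball (0 : EuclideanSpace ℝ (Fin d)) 1)) ^ (1 / ξ) *
    lam ^ (1 / ξ) * quantile G (1 - (R ^ d)⁻¹)

/-- The Fréchet distribution function `x ↦ exp (-x ^ (-ξ)) 1_{x > 0}`. -/
def frechetFun (ξ x : ℝ) : ℝ := if 0 < x then Real.exp (-x ^ (-ξ)) else 0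

lemma frechetFun_nonneg (ξ x : ℝ) : 0 ≤ frechetFun ξ x := by
  unfold frechetFun; split_ifs <;> positivity

lemma frechetFun_mono {ξ : ℝ} (hξ : 0 < ξ) : Monotone (frechetFun ξ) := by
  intro x y hxy
  by_cases hx : 0 < x
  · have hy : 0 < y := hx.trans_le hxy
    simp only [frechetFun, hx, hy, if_true]
    exact Real.exp_le_exp.2
      (neg_le_neg (Real.rpow_le_rpow_of_nonpos hx hxy (by linarith)))
  · have : frechetFun ξ x = 0 := by simp [frechetFun, hx]
    rw [this]; exact frechetFun_nonneg ξ y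

lemma frechetFun_rightCont {ξ : ℝ} (hξ : 0 < ξ) (x : ℝ) :
    ContinuousWithinAt (frechetFun ξ) (Set.Ici x) x := by
  rcases lt_trichotomy x 0 with hx | hx | hx
  · have : frechetFun ξ =ᶠ[𝓝 x] fun _ => 0 := by
      filter_upwards [Iio_mem_nhds hx] with y hy
      simp [frechetFun, not_lt.2 (le_of_lt (show y < 0 from hy))]
    exact (continuousAt_const.congr this.symm).continuousWithinAt
  · subst hx
    rw [← continuousWithinAt_Ioi_iff_Ici]
    have h0 : frechetFun ξ 0 = 0 := by simp [frechetFun]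
    rw [ContinuousWithinAt, h0]
    have h1 : Tendsto (fun y : ℝ => Real.exp (-y ^ (-ξ))) (𝓝[>] 0) (𝓝 0) :=
      Real.tendsto_exp_neg_atTop_nhds_zero.comp (tendsto_rpow_neg_nhdsGT_zero (by linarith))
    refine h1.congr' ?_
    filter_upwards [self_mem_nhdsWithin] with y hy
    simp only [frechetFun, if_pos (show (0 : ℝ) < y from hy)]
  · have h1 : ContinuousAt (fun y : ℝ => Real.exp (-y ^ (-ξ))) x :=
      ((Real.continuousAt_rpow_const x (-ξ) (Or.inl hx.ne')).neg).rexp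
    refine (h1.congr ?_).continuousWithinAt
    filter_upwards [Ioi_mem_nhds hx] with y hy
    simp only [frechetFun, if_pos (show (0 : ℝ) < y from hy)]

/-- The Fréchet distribution function as a Stieltjes function. -/
def frechetCDF (ξ : ℝ) (hξ : 0 < ξ) : StieltjesFunction ℝ where
  toFun := frechetFun ξ
  mono' := frechetFun_mono hξ
  right_continuous' := frechetFun_rightCont hξ

lemma frechetCDF_tendsto_atBot (ξ : ℝ) (hξ : 0 < ξ) :
    Tendsto (frechetCDF ξ hξ) atBot (𝓝 0) := by
  refine tendsto_const_nhds.congr' ?_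
  filter_upwards [Iic_mem_atBot (0 : ℝ)] with y hy
  change 0 = frechetFun ξ y
  simp [frechetFun, not_lt.2 (show y ≤ 0 from hy)]

lemma frechetCDF_tendsto_atTop (ξ : ℝ) (hξ : 0 < ξ) :
    Tendsto (frechetCDF ξ hξ) atTop (𝓝 1) := by
  have h1 : Tendsto (fun y : ℝ => Real.exp (-y ^ (-ξ))) atTop (𝓝 1) := by
    have := (tendsto_rpow_neg_atTop hξ).neg.rexp
    simpa using this
  refine h1.congr' ?_
  filter_upwards [Ioi_mem_atTop (0 : ℝ)] with y hy
  change _ = frechetFun ξ y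
  simp only [frechetFun, if_pos (show (0 : ℝ) < y from hy)]

/-- The Fréchet law: the probability on `ℝ` with distribution function `frechetFun ξ`. -/
def frechetLaw (ξ : ℝ) (hξ : 0 < ξ) : ProbabilityMeasure ℝ :=
  ⟨(frechetCDF ξ hξ).measure, (frechetCDF ξ hξ).isProbabilityMeasure
    (frechetCDF_tendsto_atBot ξ hξ) (frechetCDF_tendsto_atTop ξ hξ)⟩

end ShotNoise

end

/-!
The shot noise exceeds a level `t` somewhere on the ball of radius `R` exactly when the Poisson
process has a point `(x, m)` with `t < m * sup {h (y - x) ; |y| ≤ R}`, so the distribution function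
of the supremum is a void probability: the exponential of minus the intensity of this exceedance
set. Rescale `x = R u` and take `t = N(R) s`. The inner supremum tends to `‖h‖_∞` if `|u| < 1` and
to `0` if `|u| > 1`, so by regular variation the integrand tends to a constant on the unit ball and
to `0` off its closure; a Potter bound, integrable because `γ > d / ξ`, dominates it. The
normalisation makes the limit of the intensities `s ^ (-ξ)`.

As `h` is only measurable, the supremum over a closed ball need not be measurable in `x`. The
supremum over the open ball is lower semicontinuous, and the two agree almost everywhere: level sets
of both lie between the open and the closed thickening of one set, which differ by a null set.
-/

namespace ShotNoise

section WeakConvergence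

variable {ι : Type*} {l : Filter ι} [l.IsCountablyGenerated] {μ : ι → ProbabilityMeasure ℝ}
  {ν : ProbabilityMeasure ℝ}

lemma tendsto_of_forall_tendsto_Iic
    (H : ∀ x, Tendsto (fun i => (μ i : Measure ℝ).real (Set.Iic x)) l
      (𝓝 ((ν : Measure ℝ).real (Set.Iic x)))) :
    Tendsto μ l (𝓝 ν) := by
  refine (isPiSystem_Ioc (id : ℝ → ℝ) id).tendsto_probabilityMeasure_of_tendsto_of_mem ?_ ?_ ?_
  · rintro _ ⟨a, b, -, rfl⟩
    exact measurableSet_Ioc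
  · intro u hu x hx
    obtain ⟨ε, hε, hsub⟩ := Metric.isOpen_iff.1 hu x hx
    refine ⟨Set.Ioc (x - ε / 2) (x + ε / 2), ⟨x - ε / 2, x + ε / 2, by simp; linarith, rfl⟩,
      Ioc_mem_nhds (by linarith) (by linarith), fun y hy => hsub ?_⟩
    rw [Metric.mem_ball, Real.dist_eq, abs_lt]
    constructor <;> linarith [hy.1, hy.2]
  · rintro _ ⟨a, b, hab, rfl⟩
    have measure_Ioc (ρ : ProbabilityMeasure ℝ) : ((ρ (Set.Ioc a b) : ℝ≥0) : ℝ) =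
        (ρ : Measure ℝ).real (Set.Iic b) - (ρ : Measure ℝ).real (Set.Iic a) := by
      rw [← measureReal_sdiff (Set.Iic_subset_Iic.2 (id hab : a < b).le) measurableSet_Iic,
        Set.Iic_sdiff_Iic]
      rfl
    rw [← NNReal.tendsto_coe]
    simp only [id, measure_Ioc]
    exact (H b).sub (H a)

lemma tendsto_of_forall_pos_tendsto_Iic (hν : (ν : Measure ℝ).real (Set.Iic 0) = 0)
    (H : ∀ x, 0 < x → Tendsto (fun i => (μ i : Measure ℝ).real (Set.Iic x)) l
      (𝓝 ((ν : Measure ℝ).real (Set.Iic x)))) :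
    Tendsto μ l (𝓝 ν) := by
  refine tendsto_of_forall_tendsto_Iic fun x => ?_
  rcases lt_or_ge 0 x with hx | hx
  · exact H x hx
  have hνx : (ν : Measure ℝ).real (Set.Iic x) = 0 :=
    le_antisymm (hν ▸ measureReal_mono (Set.Iic_subset_Iic.2 hx)) measureReal_nonneg
  have right_cont : Tendsto (fun y => (ν : Measure ℝ).real (Set.Iic y)) (𝓝[>] 0) (𝓝 0) := by
    have h := ((cdf (ν : Measure ℝ)).right_continuous 0).mono_left
      (nhdsWithin_mono _ Set.Ioi_subset_Ici_self)
    rw [cdf_eq_real, hν] at h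
    exact h.congr fun y => cdf_eq_real _ y
  rw [hνx]
  refine tendsto_order.2 ⟨fun b hb => .of_forall fun i => hb.trans_le measureReal_nonneg,
    fun b hb => ?_⟩
  obtain ⟨y, hyb, hy⟩ := ((right_cont.eventually_lt_const hb).and self_mem_nhdsWithin).exists
  filter_upwards [(H y hy).eventually_lt_const hyb] with i hi
  exact (measureReal_mono (Set.Iic_subset_Iic.2 (hx.trans (le_of_lt hy)))).trans_lt hi

lemma tendstoInDistribution_id_of_forall_pos {Ω : Type*} [MeasurableSpace Ω] {P : Measure Ω}
    [IsProbabilityMeasure P] {X : ι → Ω → ℝ} (hX : ∀ i, AEMeasurable (X i) P)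
    (hν : (ν : Measure ℝ).real (Set.Iic 0) = 0)
    (H : ∀ x, 0 < x → Tendsto (fun i => P.real {ω | X i ω ≤ x}) l
      (𝓝 ((ν : Measure ℝ).real (Set.Iic x)))) :
    TendstoInDistribution X l (id : ℝ → ℝ) (fun _ => P) (ν : Measure ℝ) := by
  refine ⟨hX, aemeasurable_id, ?_⟩
  simp only [Measure.map_id]
  exact tendsto_of_forall_pos_tendsto_Iic hν fun x hx => (H x hx).congr fun i =>
    (map_measureReal_apply_of_aemeasurable (hX i) measurableSet_Iic).symm

lemma frechetLaw_real_Iic {ξ : ℝ} (hξ : 0 < ξ) (x : ℝ) :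
    (frechetLaw ξ hξ : Measure ℝ).real (Set.Iic x) = frechetFun ξ x := by
  change ((frechetCDF ξ hξ).measure).real (Set.Iic x) = _
  rw [measureReal_def, StieltjesFunction.measure_Iic _ (frechetCDF_tendsto_atBot ξ hξ), sub_zero]
  exact ENNReal.toReal_ofReal (frechetFun_nonneg ξ x)

end WeakConvergence

section RegularVariation

variable {f : ℝ → ℝ} {ρ : ℝ}

lemma IsRegularlyVarying.tendsto_mul_comp_const_mul (hf : IsRegularlyVarying f ρ) {ι : Type*}
    {l : Filter ι} {r t : ι → ℝ} {κ c : ℝ} (hc : 0 < c) (ht : Tendsto t l atTop)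
    (hr : Tendsto (fun i => r i * f (t i)) l (𝓝 κ)) :
    Tendsto (fun i => r i * f (c * t i)) l (𝓝 (κ * c ^ ρ)) := by
  refine (hr.mul ((hf.tendsto_ratio c hc).comp ht)).congr' ?_
  filter_upwards [ht.eventually hf.eventually_pos] with i hi
  simp only [Function.comp]
  field_simp

lemma apply_two_pow_mul_le {a x₀ : ℝ} (ha : 0 ≤ a) (hf : ∀ y, x₀ ≤ y → f (2 * y) ≤ a * f y) {x : ℝ}
    (hx₀ : x₀ ≤ x) (hx : 0 ≤ x) (k : ℕ) : f (2 ^ k * x) ≤ a ^ k * f x := by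
  induction k with
  | zero => simp
  | succ k ih =>
    have hle : x₀ ≤ 2 ^ k * x := hx₀.trans (le_mul_of_one_le_left hx (one_le_pow₀ one_le_two))
    calc f (2 ^ (k + 1) * x) = f (2 * (2 ^ k * x)) := by ring_nf
      _ ≤ a * f (2 ^ k * x) := hf _ hle
      _ ≤ a * (a ^ k * f x) := by gcongr
      _ = a ^ (k + 1) * f x := by ring

-- A Potter bound: iterate `f (2 * y) ≤ 2 ^ (-η) * f y` along the dyadic scales below `v`.
lemma IsRegularlyVarying.exists_apply_mul_le (hf : IsRegularlyVarying f ρ) (hanti : Antitone f)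
    {η : ℝ} (hη : 0 ≤ η) (hρη : ρ < -η) :
    ∃ x₀ : ℝ, ∀ x, x₀ ≤ x → ∀ v : ℝ, 1 ≤ v → f (v * x) ≤ 2 ^ η * v ^ (-η) * f x := by
  have hpow : (2 : ℝ) ^ ρ < 2 ^ (-η) := Real.rpow_lt_rpow_of_exponent_lt one_lt_two hρη
  obtain ⟨x₁, hx₁⟩ := eventually_atTop.1
    (((hf.tendsto_ratio 2 two_pos).eventually_lt_const hpow).and hf.eventually_pos)
  refine ⟨max x₁ 0, fun x hx v hv => ?_⟩
  obtain ⟨hx₁x, hx0⟩ := max_le_iff.1 hx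
  have doubling (y : ℝ) (hy : x₁ ≤ y) : f (2 * y) ≤ 2 ^ (-η) * f y :=
    ((div_lt_iff₀ (hx₁ y hy).2).1 (hx₁ y hy).1).le
  obtain ⟨k, hkv, hvk⟩ := exists_nat_pow_near hv one_lt_two
  have hfx : 0 < f x := (hx₁ x hx₁x).2
  calc f (v * x) ≤ f (2 ^ k * x) := hanti (by gcongr)
    _ ≤ ((2 : ℝ) ^ (-η)) ^ k * f x := apply_two_pow_mul_le (by positivity) doubling hx₁x hx0 k
    _ = (2 ^ η * ((2 : ℝ) ^ (k + 1)) ^ (-η)) * f x := by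
      rw [← Real.rpow_natCast, ← Real.rpow_natCast, ← Real.rpow_mul two_pos.le,
        ← Real.rpow_mul two_pos.le, ← Real.rpow_add two_pos]
      push_cast
      ring_nf
    _ ≤ 2 ^ η * v ^ (-η) * f x := by
      have : ((2 : ℝ) ^ (k + 1)) ^ (-η) ≤ v ^ (-η) :=
        Real.rpow_le_rpow_of_nonpos (by linarith) hvk.le (by linarith)
      gcongr

end RegularVariation

section TailQuantile

variable {G : Measure (Set.Ioi (0 : ℝ))} {ρ : ℝ}

lemma tail_nonneg (x : ℝ) : 0 ≤ tail G x := measureReal_nonneg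

lemma ofReal_tail [IsFiniteMeasure G] (x : ℝ) :
    ENNReal.ofReal (tail G x) = G {m | x < (m : ℝ)} :=
  ofReal_measureReal

lemma tail_antitone [IsFiniteMeasure G] : Antitone (tail G) := fun _ _ hxy =>
  measureReal_mono fun _ hm => lt_of_le_of_lt hxy hm

lemma tail_pos [IsFiniteMeasure G] (hG : IsRegularlyVarying (tail G) ρ) (x : ℝ) :
    0 < tail G x := by
  obtain ⟨y, hy, hxy⟩ := (hG.eventually_pos.and (eventually_ge_atTop x)).exists
  exact hy.trans_le (tail_antitone hxy)

lemma tendsto_tail_atTop [IsFiniteMeasure G] : Tendsto (tail G) atTop (𝓝 0) := by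
  have hempty : ⋂ x : ℝ, {m : Set.Ioi (0 : ℝ) | x < m} = ∅ :=
    Set.eq_empty_of_forall_notMem fun m hm => lt_irrefl (m : ℝ) (Set.mem_iInter.1 hm m)
  have hlim := tendsto_measure_iInter_atTop (μ := G) (s := fun x : ℝ => {m | x < (m : ℝ)})
    (fun x => (measurableSet_lt measurable_const measurable_subtype_coe).nullMeasurableSet)
    (fun _ _ hxy _ hm => lt_of_le_of_lt hxy hm) ⟨0, measure_ne_top _ _⟩
  rw [hempty, measure_empty] at hlim
  exact (ENNReal.tendsto_toReal ENNReal.zero_ne_top).comp hlim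

lemma exists_pos_tail_le [IsFiniteMeasure G] {p : ℝ} (hp : 0 < p) :
    {x : ℝ | 0 < x ∧ tail G x ≤ p}.Nonempty := by
  obtain ⟨x, hx, hx0⟩ :=
    ((tendsto_tail_atTop (G := G).eventually_le_const hp).and (eventually_gt_atTop 0)).exists
  exact ⟨x, hx0, hx⟩

variable [IsProbabilityMeasure G]

lemma measureReal_le_eq_one_sub_tail (x : ℝ) : G.real {m | (m : ℝ) ≤ x} = 1 - tail G x := by
  rw [tail, ← probReal_compl_eq_one_sub (measurableSet_lt measurable_const measurable_subtype_coe)]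
  simp only [Set.compl_ofPred, not_lt]

lemma quantile_one_sub (p : ℝ) : quantile G (1 - p) = sInf {x : ℝ | 0 < x ∧ tail G x ≤ p} := by
  simp only [quantile, measureReal_le_eq_one_sub_tail, sub_le_sub_iff_left]

lemma tail_le_of_quantile_lt {p x : ℝ} (hp : 0 < p) (hx : quantile G (1 - p) < x) :
    tail G x ≤ p := by
  rw [quantile_one_sub] at hx
  obtain ⟨y, hy, hyx⟩ := exists_lt_of_csInf_lt (exists_pos_tail_le hp) hx
  exact (tail_antitone hyx.le).trans hy.2

lemma lt_tail_of_lt_quantile {p x : ℝ} (hx0 : 0 < x) (hx : x < quantile G (1 - p)) :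
    p < tail G x := by
  rw [quantile_one_sub] at hx
  by_contra! hle
  exact notMem_of_lt_csInf hx ⟨0, fun y hy => hy.1.le⟩ ⟨hx0, hle⟩

lemma tendsto_quantile_one_sub (hG : IsRegularlyVarying (tail G) ρ) :
    Tendsto (fun p => quantile G (1 - p)) (𝓝[>] 0) atTop := by
  refine tendsto_atTop.2 fun x => ?_
  filter_upwards [nhdsWithin_le_nhds (gt_mem_nhds (tail_pos hG x)), self_mem_nhdsWithin]
    with p hpx hp
  rw [quantile_one_sub]
  refine le_csInf (exists_pos_tail_le hp) fun y hy => ?_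
  by_contra! hyx
  exact (hy.2.trans_lt hpx).not_ge (tail_antitone hyx.le)

-- For `s < 1 < t` the definition of `q = quantile G (1 - p)` gives `tail G (t * q) ≤ p` and
-- `p < tail G (s * q)`; regular variation lets `s` and `t` tend to `1`.
lemma tendsto_inv_mul_tail_quantile (hG : IsRegularlyVarying (tail G) ρ) :
    Tendsto (fun p => p⁻¹ * tail G (quantile G (1 - p))) (𝓝[>] 0) (𝓝 1) := by
  have hq := tendsto_quantile_one_sub hG
  have hratio (t : ℝ) (ht : 0 < t) : Tendsto (fun p => tail G (quantile G (1 - p)) /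
      tail G (t * quantile G (1 - p))) (𝓝[>] 0) (𝓝 (t ^ ρ)⁻¹) := by
    simpa only [Function.comp_apply, inv_div] using
      ((hG.tendsto_ratio t ht).comp hq).inv₀ (Real.rpow_pos_of_pos ht _).ne'
  have hpow : Tendsto (fun t : ℝ => (t ^ ρ)⁻¹) (𝓝 1) (𝓝 1) := by
    have h := (Real.continuousAt_rpow_const 1 ρ (Or.inl one_ne_zero)).tendsto
    simpa only [Real.one_rpow, inv_one] using h.inv₀ (by simp)
  refine tendsto_order.2 ⟨fun b hb => ?_, fun b hb => ?_⟩
  · obtain ⟨s, ⟨hbs, hs0⟩, hs1⟩ := ((((hpow.eventually_const_lt hb).and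
      (lt_mem_nhds one_pos)).filter_mono nhdsWithin_le_nhds).and
      (self_mem_nhdsWithin : Set.Iio (1 : ℝ) ∈ 𝓝[<] 1)).exists
    filter_upwards [(hratio s hs0).eventually_const_lt hbs, self_mem_nhdsWithin,
      hq.eventually_gt_atTop 0] with p hbp hp hqp
    refine hbp.trans_le ?_
    rw [div_eq_inv_mul]
    have hlt := lt_tail_of_lt_quantile (G := G) (mul_pos hs0 hqp) (mul_lt_of_lt_one_left hqp hs1)
    exact mul_le_mul_of_nonneg_right (inv_anti₀ hp hlt.le) (tail_nonneg _)
  · obtain ⟨t, htb, ht1⟩ := (((hpow.eventually_lt_const hb).filter_mono nhdsWithin_le_nhds).and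
      (self_mem_nhdsWithin : Set.Ioi (1 : ℝ) ∈ 𝓝[>] 1)).exists
    filter_upwards [(hratio t (one_pos.trans ht1)).eventually_lt_const htb, self_mem_nhdsWithin,
      hq.eventually_gt_atTop 0] with p hpb hp hqp
    refine lt_of_le_of_lt ?_ hpb
    rw [div_eq_inv_mul]
    have hle := tail_le_of_quantile_lt (G := G) hp (lt_mul_of_one_lt_left hqp ht1)
    exact mul_le_mul_of_nonneg_right (inv_anti₀ (tail_pos hG _) hle) (tail_nonneg _)

lemma tendsto_inv_pow_atTop {n : ℕ} (hn : n ≠ 0) :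
    Tendsto (fun R : ℝ => (R ^ n)⁻¹) atTop (𝓝[>] 0) :=
  tendsto_inv_atTop_nhdsGT_zero.comp (tendsto_pow_atTop hn)

lemma tendsto_quantile_one_sub_inv_pow (hG : IsRegularlyVarying (tail G) ρ) {n : ℕ} (hn : n ≠ 0) :
    Tendsto (fun R : ℝ => quantile G (1 - (R ^ n)⁻¹)) atTop atTop :=
  (tendsto_quantile_one_sub hG).comp (tendsto_inv_pow_atTop hn)

lemma tendsto_pow_mul_tail_quantile (hG : IsRegularlyVarying (tail G) ρ) {n : ℕ} (hn : n ≠ 0)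
    {c : ℝ} (hc : 0 < c) :
    Tendsto (fun R : ℝ => R ^ n * tail G (c * quantile G (1 - (R ^ n)⁻¹))) atTop (𝓝 (c ^ ρ)) := by
  have hlim := (hG.tendsto_mul_comp_const_mul hc (tendsto_quantile_one_sub hG)
    (tendsto_inv_mul_tail_quantile hG)).comp (tendsto_inv_pow_atTop hn)
  simpa only [Function.comp_def, inv_inv, one_mul] using hlim

end TailQuantile

section ExceedProb

variable {G : Measure (Set.Ioi (0 : ℝ))}

/-- The probability `G {m | t < m * b}` that a mark exceeds the threshold `t` after scaling by `b`;
for `b = 0` or `b = ∞` the product is the one of `ℝ≥0∞`. -/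
def exceedProb (G : Measure (Set.Ioi (0 : ℝ))) (t b : ℝ≥0∞) : ℝ≥0∞ :=
  G {m | t < ENNReal.ofReal (m : ℝ) * b}

lemma exceedProb_mono (t : ℝ≥0∞) : Monotone (exceedProb G t) := fun a b hab =>
  measure_mono fun m (hm : t < ENNReal.ofReal (m : ℝ) * a) =>
    show t < ENNReal.ofReal (m : ℝ) * b from hm.trans_le (by gcongr)

lemma exceedProb_ofReal [IsFiniteMeasure G] {t b : ℝ} (ht : 0 ≤ t) (hb : 0 < b) :
    exceedProb G (ENNReal.ofReal t) (ENNReal.ofReal b) = ENNReal.ofReal (tail G (b⁻¹ * t)) := by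
  rw [ofReal_tail, exceedProb]
  congr 1 with m
  simp only [Set.mem_ofPred_eq]
  rw [← ENNReal.ofReal_mul m.2.le, ENNReal.ofReal_lt_ofReal_iff_of_nonneg ht, inv_mul_lt_iff₀' hb]

variable [IsFiniteMeasure G] {ξ : ℝ} {ι : Type*} {l : Filter ι} {r t : ι → ℝ} {κ : ℝ}

lemma tendsto_mul_exceedProb_const (hG : IsRegularlyVarying (tail G) (-ξ))
    (ht : Tendsto t l atTop) (hr : Tendsto (fun i => r i * tail G (t i)) l (𝓝 κ)) {b : ℝ≥0∞}
    (hb : b ≠ 0) (hb' : b ≠ ∞) :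
    Tendsto (fun i => ENNReal.ofReal (r i) * exceedProb G (ENNReal.ofReal (t i)) b) l
      (𝓝 (ENNReal.ofReal κ * b ^ ξ)) := by
  lift b to ℝ≥0 using hb'
  have hb0 : 0 < (b : ℝ) := NNReal.coe_pos.2 (pos_iff_ne_zero.2 (by exact_mod_cast hb))
  have hlim := ENNReal.tendsto_ofReal (hG.tendsto_mul_comp_const_mul (inv_pos.2 hb0) ht hr)
  rw [Real.inv_rpow hb0.le, Real.rpow_neg hb0.le, inv_inv,
    ENNReal.ofReal_mul' (Real.rpow_nonneg hb0.le _), ← ENNReal.ofReal_rpow_of_pos hb0,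
    ENNReal.ofReal_coe_nnreal] at hlim
  refine hlim.congr' ?_
  filter_upwards [ht.eventually_ge_atTop 0] with i hi
  rw [ENNReal.ofReal_mul' (tail_nonneg _), ← exceedProb_ofReal hi hb0,
    ENNReal.ofReal_coe_nnreal]

-- Monotonicity in the scale upgrades convergence at each fixed scale to convergence along `a`.
lemma tendsto_mul_exceedProb (hξ : 0 < ξ) (hG : IsRegularlyVarying (tail G) (-ξ))
    (ht : Tendsto t l atTop) (hr : Tendsto (fun i => r i * tail G (t i)) l (𝓝 κ))
    {a : ι → ℝ≥0∞} {α : ℝ≥0∞} (hα : α ≠ ∞) (ha : Tendsto a l (𝓝 α)) :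
    Tendsto (fun i => ENNReal.ofReal (r i) * exceedProb G (ENNReal.ofReal (t i)) (a i)) l
      (𝓝 (ENNReal.ofReal κ * α ^ ξ)) := by
  have hcont : Tendsto (fun b => ENNReal.ofReal κ * b ^ ξ) (𝓝 α) (𝓝 (ENNReal.ofReal κ * α ^ ξ)) :=
    ENNReal.Tendsto.const_mul (ENNReal.continuous_rpow_const.tendsto α)
      (Or.inr ENNReal.ofReal_ne_top)
  refine tendsto_order.2 ⟨fun c hc => ?_, fun c hc => ?_⟩
  · have hα0 : 0 < α := by
      refine pos_iff_ne_zero.2 fun h0 => ?_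
      simp [h0, ENNReal.zero_rpow_of_pos hξ] at hc
    have : (𝓝[<] α).NeBot := nhdsLT_neBot_of_exists_lt ⟨0, hα0⟩
    obtain ⟨b, ⟨hcb, hb0⟩, hbα⟩ := ((((hcont.eventually_const_lt hc).and
      (lt_mem_nhds hα0)).filter_mono nhdsWithin_le_nhds).and
      (self_mem_nhdsWithin : Set.Iio α ∈ 𝓝[<] α)).exists
    have hlim := tendsto_mul_exceedProb_const hG ht hr hb0.ne' (ne_top_of_lt hbα)
    filter_upwards [hlim.eventually_const_lt hcb, ha.eventually_const_lt hbα] with i hi hbi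
    exact hi.trans_le (by gcongr; exact exceedProb_mono _ hbi.le)
  · have : (𝓝[>] α).NeBot := nhdsGT_neBot_of_exists_gt ⟨∞, hα.lt_top⟩
    obtain ⟨b, ⟨hbc, hb⟩, hαb⟩ := ((((hcont.eventually_lt_const hc).and
      (gt_mem_nhds hα.lt_top)).filter_mono nhdsWithin_le_nhds).and
      (self_mem_nhdsWithin : Set.Ioi α ∈ 𝓝[>] α)).exists
    have hlim := tendsto_mul_exceedProb_const hG ht hr (ne_bot_of_gt hαb) hb.ne
    filter_upwards [hlim.eventually_lt_const hbc, ha.eventually_lt_const hαb] with i hi hib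
    exact lt_of_le_of_lt (by gcongr; exact exceedProb_mono _ hib.le) hi

lemma eventually_exceedProb_le (hG : IsRegularlyVarying (tail G) (-ξ)) {η : ℝ} (hη : 0 ≤ η)
    (hηξ : η < ξ) {D : ℝ} (hD : 0 < D) :
    ∀ᶠ s in atTop, ∀ v : ℝ, 1 ≤ v →
      exceedProb G (ENNReal.ofReal s) (ENNReal.ofReal (D * v⁻¹)) ≤
        ENNReal.ofReal (tail G (D⁻¹ * s)) * ENNReal.ofReal (2 ^ η * v ^ (-η)) := by
  obtain ⟨x₀, hx₀⟩ := hG.exists_apply_mul_le tail_antitone hη (neg_lt_neg hηξ)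
  filter_upwards [eventually_ge_atTop 0, eventually_ge_atTop (D * x₀)] with s hs hsx v hv
  have : 0 < v := one_pos.trans_le hv
  rw [exceedProb_ofReal hs (by positivity), ← ENNReal.ofReal_mul (tail_nonneg _), mul_inv,
    inv_inv, mul_comm D⁻¹ v, mul_assoc, mul_comm (tail G _)]
  exact ENNReal.ofReal_le_ofReal (hx₀ _ (by rwa [le_inv_mul_iff₀ hD]) v hv)

end ExceedProb

section Poisson

variable {Ω X : Type*} [MeasurableSpace Ω] [TopologicalSpace X] [MeasurableSpace X]
  {Φ : Ω → Set X} {ν : Measure X} {P : Measure Ω}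

lemma ae_of_one_le_measureReal [IsProbabilityMeasure P] {p : Ω → Prop}
    (hp : MeasurableSet {ω | p ω}) (hP : 1 ≤ P.real {ω | p ω}) : ∀ᵐ ω ∂P, p ω := by
  refine (mem_ae_iff_prob_eq_one hp).2 ?_
  rw [← ofReal_measureReal (μ := P), le_antisymm measureReal_le_one hP, ENNReal.ofReal_one]

lemma IsPoissonPointProcess.measurableSet_void (hΦ : IsPoissonPointProcess Φ ν P) {A : Set X}
    (hA : MeasurableSet A) : MeasurableSet {ω | Φ ω ∩ A = ∅} := by
  simp only [← Set.encard_eq_zero]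
  exact hΦ.measurable_count A hA (measurableSet_singleton 0)

lemma IsPoissonPointProcess.measureReal_void (hΦ : IsPoissonPointProcess Φ ν P) {A : Set X}
    (hA : MeasurableSet A) (hν : ν A ≠ ∞) :
    P.real {ω | Φ ω ∩ A = ∅} = Real.exp (-(ν A).toReal) := by
  have hlaw := congrArg (fun μ : Measure ℕ∞ => μ.real {0}) (hΦ.count_law A hA hν)
  rw [map_measureReal_apply (hΦ.measurable_count A hA) (measurableSet_singleton 0),
    map_measureReal_apply .of_discrete (measurableSet_singleton 0)] at hlaw
  have hcast : (fun k : ℕ => (k : ℕ∞)) ⁻¹' {0} = {0} := by ext; simp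
  have hvoid : (fun ω => (Φ ω ∩ A).encard) ⁻¹' {0} = {ω | Φ ω ∩ A = ∅} := by ext; simp
  rw [hcast, hvoid, poissonMeasure_real_singleton] at hlaw
  simpa [ENNReal.coe_toNNReal_eq_toReal] using hlaw

lemma IsPoissonPointProcess.ae_void [IsProbabilityMeasure P] (hΦ : IsPoissonPointProcess Φ ν P)
    {A : Set X} (hA : MeasurableSet A) (hν : ν A = 0) : ∀ᵐ ω ∂P, Φ ω ∩ A = ∅ := by
  refine ae_of_one_le_measureReal (hΦ.measurableSet_void hA) ?_
  rw [hΦ.measureReal_void hA (by simp [hν])]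
  simp [hν]

end Poisson

section MarkedSup

variable {E : Type*}

/-- The supremum of `m * U x` over the marked points `(x, m)` of `S`. -/
noncomputable def markedSup (U : E → ℝ≥0∞) (S : Set (E × Set.Ioi (0 : ℝ))) : ℝ≥0∞ :=
  ⨆ φ ∈ S, ENNReal.ofReal (φ.2 : ℝ) * U φ.1

/-- The marked points contributing more than `t` to `markedSup U`: the supremum is at most `t` if
and only if this set contains no point of the configuration. -/
def exceedance (U : E → ℝ≥0∞) (t : ℝ≥0∞) : Set (E × Set.Ioi (0 : ℝ)) :=
  {φ | t < ENNReal.ofReal (φ.2 : ℝ) * U φ.1}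

lemma markedSup_le_iff (U : E → ℝ≥0∞) (S : Set (E × Set.Ioi (0 : ℝ))) (t : ℝ≥0∞) :
    markedSup U S ≤ t ↔ S ∩ exceedance U t = ∅ := by
  simp only [markedSup, iSup_le_iff, Set.eq_empty_iff_forall_notMem, exceedance, Set.mem_inter_iff,
    Set.mem_ofPred_eq, not_and, not_lt]

variable [MeasurableSpace E] {U V : E → ℝ≥0∞}

lemma measurableSet_exceedance (hU : Measurable U) (t : ℝ≥0∞) :
    MeasurableSet (exceedance U t) :=
  measurableSet_lt measurable_const
    ((measurable_subtype_coe.comp measurable_snd).ennreal_ofReal.mul (hU.comp measurable_fst))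

lemma prod_exceedance {G : Measure (Set.Ioi (0 : ℝ))} [SFinite G] (μ : Measure E)
    (hU : Measurable U) (c t : ℝ≥0∞) :
    (μ.prod (c • G)) (exceedance U t) = c * ∫⁻ x, exceedProb G t (U x) ∂μ := by
  rw [Measure.prod_apply (measurableSet_exceedance hU t)]
  exact lintegral_const_mul _ ((exceedProb_mono t).measurable.comp hU)

variable {Ω : Type*} [MeasurableSpace Ω] [TopologicalSpace E]
  {Φ : Ω → Set (E × Set.Ioi (0 : ℝ))} {P : Measure Ω} {ν : Measure (E × Set.Ioi (0 : ℝ))}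

lemma measurable_markedSup (hΦ : IsPoissonPointProcess Φ ν P) (hU : Measurable U) :
    Measurable fun ω => markedSup U (Φ ω) := by
  refine measurable_of_Iic fun t => ?_
  simp only [Set.preimage, Set.mem_Iic, markedSup_le_iff]
  exact hΦ.measurableSet_void (measurableSet_exceedance hU t)

lemma measureReal_markedSup_le (hΦ : IsPoissonPointProcess Φ ν P) (hU : Measurable U)
    {t : ℝ≥0∞} (hν : ν (exceedance U t) ≠ ∞) :
    P.real {ω | markedSup U (Φ ω) ≤ t} = Real.exp (-(ν (exceedance U t)).toReal) := by
  simp only [markedSup_le_iff]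
  exact hΦ.measureReal_void (measurableSet_exceedance hU t) hν

variable [IsProbabilityMeasure P]

lemma markedSup_ae_congr {μ : Measure E} {ρ : Measure (Set.Ioi (0 : ℝ))} [SFinite ρ]
    (hΦ : IsPoissonPointProcess Φ (μ.prod ρ) P) (hUV : U =ᵐ[μ] V) :
    (fun ω => markedSup U (Φ ω)) =ᵐ[P] fun ω => markedSup V (Φ ω) := by
  obtain ⟨N, hN, hNm, hN0⟩ := exists_measurable_superset_of_null (ae_iff.1 hUV)
  have hnull : (μ.prod ρ) (N ×ˢ Set.univ) = 0 := by simp [hN0]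
  filter_upwards [hΦ.ae_void (hNm.prod .univ) hnull] with ω hω
  refine biSup_congr fun φ hφ => ?_
  have hφN : φ.1 ∉ N := fun hmem =>
    Set.eq_empty_iff_forall_notMem.1 hω φ ⟨hφ, hmem, Set.mem_univ _⟩
  rw [not_not.1 fun hne => hφN (hN hne)]

lemma ae_markedSup_lt_top (hΦ : IsPoissonPointProcess Φ ν P) (hU : Measurable U) {t : ℕ → ℝ≥0∞}
    (ht : ∀ k, t k ≠ ∞) (hlim : Tendsto (fun k => ν (exceedance U (t k))) atTop (𝓝 0)) :
    ∀ᵐ ω ∂P, markedSup U (Φ ω) < ∞ := by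
  have hexp : Tendsto (fun k => Real.exp (-(ν (exceedance U (t k))).toReal)) atTop (𝓝 1) := by
    simpa using ((ENNReal.tendsto_toReal ENNReal.zero_ne_top).comp hlim).neg.rexp
  refine ae_of_one_le_measureReal (measurable_markedSup hΦ hU measurableSet_Iio)
    (le_of_tendsto hexp ?_)
  filter_upwards [hlim.eventually_lt_const one_pos] with k hk
  rw [← measureReal_markedSup_le hΦ hU (ne_top_of_lt hk)]
  exact measureReal_mono fun ω hω => lt_of_le_of_lt hω (ht k).lt_top

end MarkedSup

section TranslateSup

variable {E : Type*}

/-- The supremum of the translate `h (· - x)` over `B`: the largest value on `B` of the shot noise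
response to a unit mark at `x`. -/
noncomputable def translateSup [Sub E] (h : E → ℝ≥0∞) (B : Set E) (x : E) : ℝ≥0∞ :=
  ⨆ y ∈ B, h (y - x)

lemma iSup_shotNoise_eq_markedSup [Sub E] (h : E → ℝ≥0∞) (B : Set E)
    (S : Set (E × Set.Ioi (0 : ℝ))) :
    (⨆ y ∈ B, ⨆ φ ∈ S, ENNReal.ofReal (φ.2 : ℝ) * h (y - φ.1)) =
      markedSup (translateSup h B) S := by
  simp only [markedSup, translateSup, ENNReal.mul_iSup]
  exact iSup₂_comm _

lemma translateSup_mono [Sub E] (h : E → ℝ≥0∞) {B B' : Set E} (hB : B ⊆ B') :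
    translateSup h B ≤ translateSup h B' := fun _ => biSup_mono hB

lemma lt_translateSup_iff [AddGroup E] {h : E → ℝ≥0∞} {B : Set E} {x : E} {t : ℝ≥0∞} :
    t < translateSup h B x ↔ ∃ z, t < h z ∧ z + x ∈ B := by
  simp only [translateSup, lt_iSup_iff, exists_prop]
  exact ⟨fun ⟨y, hy, hlt⟩ => ⟨y - x, hlt, by simpa⟩, fun ⟨z, hlt, hz⟩ => ⟨z + x, hz, by simpa⟩⟩

lemma measurable_translateSup [AddGroup E] [TopologicalSpace E] [ContinuousAdd E]
    [MeasurableSpace E] [OpensMeasurableSpace E] (h : E → ℝ≥0∞) {B : Set E} (hB : IsOpen B) :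
    Measurable (translateSup h B) := by
  refine measurable_of_Ioi fun t => IsOpen.measurableSet ?_
  have hlevel : translateSup h B ⁻¹' Set.Ioi t = ⋃ z ∈ {z | t < h z}, (z + ·) ⁻¹' B := by
    ext x
    simp [lt_translateSup_iff]
  rw [hlevel]
  exact isOpen_biUnion fun z _ => hB.preimage (continuous_const_add z)

variable [NormedAddCommGroup E]

lemma setOf_lt_translateSup_ball (h : E → ℝ≥0∞) (R : ℝ) (t : ℝ≥0∞) :
    {x | t < translateSup h (Metric.ball 0 R) x} = Metric.thickening R {a | t < h (-a)} := by
  ext x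
  simp only [Set.mem_ofPred_eq, lt_translateSup_iff, mem_ball_zero_iff, Metric.mem_thickening_iff]
  exact ⟨fun ⟨z, hz, hx⟩ => ⟨-z, by simpa, by simpa [dist_eq_norm, add_comm] using hx⟩,
    fun ⟨a, ha, hx⟩ => ⟨-a, ha, by simpa [dist_eq_norm, neg_add_eq_sub] using hx⟩⟩

lemma setOf_lt_translateSup_closedBall_subset (h : E → ℝ≥0∞) (R : ℝ) (t : ℝ≥0∞) :
    {x | t < translateSup h (Metric.closedBall 0 R) x} ⊆
      Metric.cthickening R {a | t < h (-a)} := by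
  intro x hx
  obtain ⟨z, hz, hzx⟩ := lt_translateSup_iff.1 hx
  refine Metric.mem_cthickening_of_dist_le x (-z) R _ (by simpa) ?_
  simpa [dist_eq_norm, add_comm] using hzx

variable [NormedSpace ℝ E] [FiniteDimensional ℝ E] [MeasurableSpace E] [BorelSpace E]
  (μ : Measure E) [μ.IsAddHaarMeasure]

-- Write `cthickening R A` as `cthickening (r i) (s i)` with `r i → 0`; shrinking every `r i` by a
-- factor `2` makes the thickening a subset of `thickening R A`, and by Lebesgue density does not
-- change the upper limit of the sequence.
lemma thickening_ae_eq_cthickening {R : ℝ} (hR : 0 < R) (A : Set E) :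
    Metric.thickening R A =ᵐ[μ] Metric.cthickening R A := by
  set r : ℕ → ℝ := fun i => R / (i + 2)
  have hr0 (i : ℕ) : 0 < r i := by positivity
  have hrR (i : ℕ) : r i < R := div_lt_self hR (by linarith [i.cast_nonneg (α := ℝ)])
  have hlim : Tendsto r atTop (𝓝 0) :=
    (tendsto_natCast_atTop_atTop.atTop_add tendsto_const_nhds).const_div_atTop R
  have hthick (i : ℕ) {ε : ℝ} (hε : 0 ≤ ε) :
      Metric.cthickening ε (Metric.thickening (R - r i) A) = Metric.cthickening (ε + (R - r i)) A :=
    cthickening_thickening hε (sub_pos.2 (hrR i)) A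
  have hae := blimsup_cthickening_mul_ae_eq μ (fun _ => True)
    (fun i => Metric.thickening (R - r i) A) (one_half_pos (α := ℝ)) r hlim
  simp only [blimsup_true, hthick _ (hr0 _).le, hthick _ (half_pos (hr0 _)).le,
    one_div, inv_mul_eq_div, add_sub_cancel, limsup_const] at hae
  refine (Metric.thickening_subset_cthickening R A).eventuallyLE.antisymm (hae.symm.le.trans ?_)
  refine LE.le.eventuallyLE (limsup_le_of_le (by isBoundedDefault) (.of_forall fun i => ?_))
  exact Metric.cthickening_subset_thickening' hR (by linarith [hr0 i]) A

lemma translateSup_closedBall_ae_eq (h : E → ℝ≥0∞) {R : ℝ} (hR : 0 < R) :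
    translateSup h (Metric.closedBall 0 R) =ᵐ[μ] translateSup h (Metric.ball 0 R) := by
  have hlevel : ∀ᵐ x ∂μ, ∀ q : ℚ, ENNReal.ofReal q < translateSup h (Metric.closedBall 0 R) x →
      ENNReal.ofReal q < translateSup h (Metric.ball 0 R) x := by
    refine ae_all_iff.2 fun q => ?_
    filter_upwards [(thickening_ae_eq_cthickening μ hR
      {a | ENNReal.ofReal q < h (-a)}).symm.le] with x hx hq
    rw [← setOf_lt_translateSup_ball] at hx
    exact hx (setOf_lt_translateSup_closedBall_subset h R _ hq)
  filter_upwards [hlevel] with x hx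
  refine le_antisymm ?_ (translateSup_mono h Metric.ball_subset_closedBall x)
  by_contra! hlt
  obtain ⟨q, -, hq, hq'⟩ := ENNReal.lt_iff_exists_rat_btwn.1 hlt
  exact (hx q hq').not_gt hq

lemma aemeasurable_markedSup_translateSup_closedBall {h : E → ℝ≥0∞} (hh : Measurable h)
    {ρ : Measure (Set.Ioi (0 : ℝ))} [SFinite ρ] {Ω : Type*} [MeasurableSpace Ω] {P : Measure Ω}
    [IsProbabilityMeasure P] {Φ : Ω → Set (E × Set.Ioi (0 : ℝ))}
    (hΦ : IsPoissonPointProcess Φ (μ.prod ρ) P) (R : ℝ) :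
    AEMeasurable (fun ω => markedSup (translateSup h (Metric.closedBall 0 R)) (Φ ω)) P := by
  rcases lt_trichotomy R 0 with hR | rfl | hR
  · simp [translateSup, Metric.closedBall_eq_empty.2 hR, markedSup]
  · have heq : translateSup h (Metric.closedBall 0 0) = fun x => h (0 - x) := by
      ext x
      simp [translateSup]
    rw [heq]
    exact (measurable_markedSup hΦ (by fun_prop)).aemeasurable
  · have hball := measurable_translateSup h (Metric.isOpen_ball (x := (0 : E)) (ε := R))
    exact (measurable_markedSup hΦ hball).aemeasurable.congr
      (markedSup_ae_congr hΦ (translateSup_closedBall_ae_eq μ h hR)).symm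

end TranslateSup

section Decay

variable {E : Type*} [NormedAddCommGroup E] {h : E → ℝ≥0∞} {γ D : ℝ}

lemma min_enorm_rpow_neg_one_le (hγ : 0 ≤ γ) (x : E) :
    min (‖x‖ₑ ^ (-γ)) 1 ≤ ENNReal.ofReal (2 ^ γ * ((1 + ‖x‖) ^ γ)⁻¹) := by
  have hx := norm_nonneg x
  rw [← div_eq_mul_inv, ← Real.div_rpow two_pos.le (by positivity)]
  rcases le_total ‖x‖ 1 with hx1 | hx1
  · refine (min_le_right _ _).trans (ENNReal.one_le_ofReal.2 (Real.one_le_rpow ?_ hγ))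
    rw [one_le_div (by positivity)]
    linarith
  · refine (min_le_left _ _).trans ?_
    have hx0 : 0 < ‖x‖ := by linarith
    rw [← ofReal_norm, ENNReal.ofReal_rpow_of_pos hx0, Real.rpow_neg hx, ← Real.inv_rpow hx]
    gcongr
    rw [inv_le_comm₀ hx0 (by positivity), inv_div]
    linarith

lemma iSup_ne_top_of_decay (hγ : 0 ≤ γ) (hD₀ : 0 ≤ D)
    (hD : ∀ x, h x ≤ ENNReal.ofReal (D * ((1 + ‖x‖) ^ γ)⁻¹)) : (⨆ x, h x) ≠ ∞ := by
  refine ne_top_of_le_ne_top (ENNReal.ofReal_ne_top (r := D)) (iSup_le fun x => (hD x).trans ?_)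
  gcongr
  exact mul_le_of_le_one_right hD₀ (inv_le_one_of_one_le₀
    (Real.one_le_rpow (by linarith [norm_nonneg x]) hγ))

lemma translateSup_ball_le (hγ : 0 ≤ γ) (hD₀ : 0 ≤ D)
    (hD : ∀ x, h x ≤ ENNReal.ofReal (D * ((1 + ‖x‖) ^ γ)⁻¹)) {R b : ℝ} {x : E} (hb : 0 < b)
    (hbx : b ≤ max 1 (1 + (‖x‖ - R))) :
    translateSup h (Metric.ball 0 R) x ≤ ENNReal.ofReal (D * (b ^ γ)⁻¹) := by
  refine iSup₂_le fun y hy => (hD _).trans ?_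
  have hby : b ≤ 1 + ‖y - x‖ := by
    have hyR : ‖y‖ < R := by simpa using hy
    have htri : ‖x‖ - ‖y‖ ≤ ‖y - x‖ := norm_sub_rev y x ▸ norm_sub_norm_le x y
    exact hbx.trans (max_le (by linarith [norm_nonneg (y - x)]) (by linarith))
  gcongr

variable [NormedSpace ℝ E]

lemma translateSup_ball_smul_le (hγ : 0 ≤ γ) (hD₀ : 0 ≤ D)
    (hD : ∀ x, h x ≤ ENNReal.ofReal (D * ((1 + ‖x‖) ^ γ)⁻¹)) {R : ℝ} (hR : 1 ≤ R) (u : E) :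
    translateSup h (Metric.ball 0 R) (R • u) ≤
      ENNReal.ofReal (D * 2 ^ γ * ((1 + ‖u‖) ^ γ)⁻¹) := by
  have := norm_nonneg u
  refine (translateSup_ball_le hγ hD₀ hD (b := (1 + ‖u‖) / 2) (by positivity) ?_).trans_eq ?_
  · rw [norm_smul, Real.norm_of_nonneg (by linarith)]
    rcases le_total ‖u‖ 1 with hu1 | hu1
    · exact le_max_of_le_left (by linarith)
    · exact le_max_of_le_right (by nlinarith)
  · rw [Real.div_rpow (by positivity) two_pos.le, inv_div, ← div_eq_mul_inv, mul_div_assoc]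

lemma tendsto_translateSup_ball_smul_of_norm_lt_one (h : E → ℝ≥0∞) {u : E} (hu : ‖u‖ < 1) :
    Tendsto (fun R : ℝ => translateSup h (Metric.ball 0 R) (R • u)) atTop (𝓝 (⨆ x, h x)) := by
  refine tendsto_order.2 ⟨fun b hb => ?_, fun b hb => .of_forall fun R =>
    (iSup₂_le fun y _ => le_iSup h _).trans_lt hb⟩
  obtain ⟨z, hz⟩ := lt_iSup_iff.1 hb
  filter_upwards [eventually_gt_atTop (‖z‖ / (1 - ‖u‖)), eventually_gt_atTop 0] with R hR hR0
  rw [div_lt_iff₀ (by linarith)] at hR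
  refine lt_translateSup_iff.2 ⟨z, hz, mem_ball_zero_iff.2 ?_⟩
  calc ‖z + R • u‖ ≤ ‖z‖ + R * ‖u‖ := by
        simpa [norm_smul, abs_of_pos hR0] using norm_add_le z (R • u)
    _ < R := by linarith

lemma tendsto_translateSup_ball_smul_of_one_lt_norm (hγ : 0 < γ) (hD₀ : 0 ≤ D)
    (hD : ∀ x, h x ≤ ENNReal.ofReal (D * ((1 + ‖x‖) ^ γ)⁻¹)) {u : E} (hu : 1 < ‖u‖) :
    Tendsto (fun R : ℝ => translateSup h (Metric.ball 0 R) (R • u)) atTop (𝓝 0) := by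
  have hlim : Tendsto (fun R : ℝ => D * ((1 + R * (‖u‖ - 1)) ^ γ)⁻¹) atTop (𝓝 0) := by
    simpa using ((tendsto_rpow_atTop hγ).comp (tendsto_atTop_add_const_left _ 1
      (tendsto_id.atTop_mul_const (sub_pos.2 hu)))).inv_tendsto_atTop.const_mul D
  refine tendsto_of_tendsto_of_tendsto_of_le_of_le' tendsto_const_nhds
    (by simpa using ENNReal.tendsto_ofReal hlim) (.of_forall fun _ => zero_le) ?_
  filter_upwards [eventually_ge_atTop 0] with R hR
  refine translateSup_ball_le hγ.le hD₀ hD (by nlinarith) (le_max_of_le_right ?_)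
  rw [norm_smul, Real.norm_of_nonneg hR]
  linarith

lemma tendsto_mul_exceedProb_translateSup {G : Measure (Set.Ioi (0 : ℝ))} [IsFiniteMeasure G]
    {ξ : ℝ} (hξ : 0 < ξ) (hG : IsRegularlyVarying (tail G) (-ξ)) (hγ : 0 < γ) (hD₀ : 0 ≤ D)
    (hD : ∀ x, h x ≤ ENNReal.ofReal (D * ((1 + ‖x‖) ^ γ)⁻¹)) {r t : ℝ → ℝ} {κ : ℝ}
    (ht : Tendsto t atTop atTop) (hκ : Tendsto (fun R => r R * tail G (t R)) atTop (𝓝 κ)) {u : E}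
    (hu : ‖u‖ ≠ 1) :
    Tendsto (fun R : ℝ => ENNReal.ofReal (r R) * exceedProb G (ENNReal.ofReal (t R))
        (translateSup h (Metric.ball 0 R) (R • u))) atTop
      (𝓝 ((Metric.ball 0 1).indicator (fun _ => ENNReal.ofReal κ * (⨆ x, h x) ^ ξ) u)) := by
  rcases lt_or_gt_of_ne hu with hu1 | hu1
  · rw [Set.indicator_of_mem (mem_ball_zero_iff.2 hu1)]
    exact tendsto_mul_exceedProb hξ hG ht hκ (iSup_ne_top_of_decay hγ.le hD₀ hD)
      (tendsto_translateSup_ball_smul_of_norm_lt_one h hu1)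
  · rw [Set.indicator_of_notMem (by simpa using hu1.le)]
    simpa [ENNReal.zero_rpow_of_pos hξ] using tendsto_mul_exceedProb hξ hG ht hκ
      ENNReal.zero_ne_top (tendsto_translateSup_ball_smul_of_one_lt_norm hγ hD₀ hD hu1)

end Decay

section Intensity

variable {E : Type*} [NormedAddCommGroup E] [NormedSpace ℝ E] [FiniteDimensional ℝ E]
  [MeasurableSpace E] [BorelSpace E] (μ : Measure E) [μ.IsAddHaarMeasure]
  {G : Measure (Set.Ioi (0 : ℝ))} {h : E → ℝ≥0∞} {γ D ξ : ℝ}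

open Module (finrank)

lemma lintegral_eq_pow_mul_lintegral_smul {f : E → ℝ≥0∞} (hf : Measurable f) {R : ℝ}
    (hR : 0 < R) : ∫⁻ x, f x ∂μ = ENNReal.ofReal (R ^ finrank ℝ E) * ∫⁻ u, f (R • u) ∂μ := by
  have hpow : 0 < R ^ finrank ℝ E := by positivity
  rw [← lintegral_map hf (measurable_const_smul R), Measure.map_addHaar_smul μ hR.ne',
    abs_of_pos (inv_pos.2 hpow), lintegral_smul_measure, smul_eq_mul, ← mul_assoc,
    ← ENNReal.ofReal_mul hpow.le, mul_inv_cancel₀ hpow.ne', ENNReal.ofReal_one, one_mul]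

lemma prod_exceedance_translateSup [SFinite G] (h : E → ℝ≥0∞) {R : ℝ} (hR : 0 < R)
    (c t : ℝ≥0∞) :
    (μ.prod (c • G)) (exceedance (translateSup h (Metric.ball 0 R)) t) =
      c * (ENNReal.ofReal (R ^ finrank ℝ E) *
        ∫⁻ u, exceedProb G t (translateSup h (Metric.ball 0 R) (R • u)) ∂μ) := by
  have hU := measurable_translateSup h (Metric.isOpen_ball (x := (0 : E)) (ε := R))
  have hprob : Measurable fun x => exceedProb G t (translateSup h (Metric.ball 0 R) x) :=
    (exceedProb_mono t).measurable.comp hU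
  rw [prod_exceedance μ hU, lintegral_eq_pow_mul_lintegral_smul μ hprob hR]

variable [IsFiniteMeasure G]

-- Choose `η < ξ` with `γ * η > finrank ℝ E`: the Potter bound then gives an integrable majorant.
lemma exists_exceedProb_translateSup_le (hξ : 0 < ξ) (hG : IsRegularlyVarying (tail G) (-ξ))
    (hγ : finrank ℝ E / ξ < γ) (hD₀ : 0 < D)
    (hD : ∀ x, h x ≤ ENNReal.ofReal (D * ((1 + ‖x‖) ^ γ)⁻¹)) :
    ∃ D' > 0, ∃ g : E → ℝ≥0∞, ∫⁻ u, g u ∂μ ≠ ∞ ∧ ∀ᶠ s in atTop, ∀ R : ℝ, 1 ≤ R → ∀ u,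
      exceedProb G (ENNReal.ofReal s) (translateSup h (Metric.ball 0 R) (R • u)) ≤
        ENNReal.ofReal (tail G (D' * s)) * g u := by
  have hγ₀ : 0 < γ := lt_of_le_of_lt (by positivity) hγ
  obtain ⟨η, hη, hηξ⟩ := exists_between ((div_lt_comm₀ hξ hγ₀).1 hγ)
  have hη₀ : 0 ≤ η := le_trans (by positivity) hη.le
  have hint : ∫⁻ u : E, ENNReal.ofReal (2 ^ η * ((1 + ‖u‖) ^ γ) ^ (-η)) ∂μ ≠ ∞ := by
    have hexp (u : E) : ENNReal.ofReal (2 ^ η * ((1 + ‖u‖) ^ γ) ^ (-η)) =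
        ENNReal.ofReal (2 ^ η) * ENNReal.ofReal ((1 + ‖u‖) ^ (-(γ * η))) := by
      rw [ENNReal.ofReal_mul (by positivity), ← Real.rpow_mul (by positivity), mul_neg]
    simp only [hexp]
    rw [lintegral_const_mul' _ _ ENNReal.ofReal_ne_top]
    exact ENNReal.mul_ne_top ENNReal.ofReal_ne_top
      (finite_integral_one_add_norm ((div_lt_iff₀' hγ₀).1 hη)).ne
  have hD' : 0 < D * 2 ^ γ := by positivity
  refine ⟨_, inv_pos.2 hD', _, hint, ?_⟩
  filter_upwards [eventually_exceedProb_le hG hη₀ hηξ hD'] with s hs R hR u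
  exact (exceedProb_mono _ (translateSup_ball_smul_le hγ₀.le hD₀.le hD hR u)).trans
    (hs _ (Real.one_le_rpow (by linarith [norm_nonneg u]) hγ₀.le))

lemma tendsto_pow_mul_lintegral_exceedProb (hξ : 0 < ξ) (hG : IsRegularlyVarying (tail G) (-ξ))
    (hγ : finrank ℝ E / ξ < γ) (hD₀ : 0 < D)
    (hD : ∀ x, h x ≤ ENNReal.ofReal (D * ((1 + ‖x‖) ^ γ)⁻¹)) {t : ℝ → ℝ} {κ : ℝ}
    (ht : Tendsto t atTop atTop)
    (hκ : Tendsto (fun R => R ^ finrank ℝ E * tail G (t R)) atTop (𝓝 κ)) :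
    Tendsto (fun R : ℝ => ENNReal.ofReal (R ^ finrank ℝ E) * ∫⁻ u, exceedProb G
        (ENNReal.ofReal (t R)) (translateSup h (Metric.ball 0 R) (R • u)) ∂μ) atTop
      (𝓝 (ENNReal.ofReal κ * (⨆ x, h x) ^ ξ * μ (Metric.ball 0 1))) := by
  have hγ₀ : 0 < γ := lt_of_le_of_lt (by positivity) hγ
  obtain ⟨D', hD', g, hg, hbound⟩ := exists_exceedProb_translateSup_le μ hξ hG hγ hD₀ hD
  have htail := hG.tendsto_mul_comp_const_mul hD' ht hκ
  rw [← setLIntegral_const, ← lintegral_indicator measurableSet_ball]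
  simp_rw [← lintegral_const_mul' _ _ ENNReal.ofReal_ne_top]
  refine tendsto_lintegral_filter_of_dominated_convergence
    (fun u => ENNReal.ofReal (κ * D' ^ (-ξ) + 1) * g u) (.of_forall fun R => ?_) ?_ ?_ ?_
  · exact ((exceedProb_mono _).measurable.comp ((measurable_translateSup h
      Metric.isOpen_ball).comp (measurable_const_smul R))).const_mul _
  · filter_upwards [ht.eventually hbound, htail.eventually_le_const (lt_add_one _),
      eventually_ge_atTop 1] with R hR hRtail hR1
    refine .of_forall fun u => ?_
    calc _ ≤ ENNReal.ofReal (R ^ finrank ℝ E) * (ENNReal.ofReal (tail G (D' * t R)) * g u) := by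
          gcongr
          exact hR R hR1 u
      _ ≤ ENNReal.ofReal (κ * D' ^ (-ξ) + 1) * g u := by
          rw [← mul_assoc, ← ENNReal.ofReal_mul (by positivity)]
          gcongr
  · rw [lintegral_const_mul' _ _ ENNReal.ofReal_ne_top]
    exact ENNReal.mul_ne_top ENNReal.ofReal_ne_top hg
  · filter_upwards [measure_eq_zero_iff_ae_notMem.1
      (Measure.addHaar_sphere_of_ne_zero μ 0 one_ne_zero)] with u hu
    exact tendsto_mul_exceedProb_translateSup hξ hG hγ₀ hD₀.le hD ht hκ
      (mt mem_sphere_zero_iff_norm.2 hu)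

end Intensity

section FrechetLimit

variable {E : Type*} [NormedAddCommGroup E] [NormedSpace ℝ E] [FiniteDimensional ℝ E]
  [MeasurableSpace E] [BorelSpace E] {μ : Measure E} [μ.IsAddHaarMeasure]
  {G : Measure (Set.Ioi (0 : ℝ))} {h : E → ℝ≥0∞} {γ D ξ lam : ℝ}
  {Ω : Type*} [MeasurableSpace Ω] {P : Measure Ω} [IsProbabilityMeasure P]
  {Φ : Ω → Set (E × Set.Ioi (0 : ℝ))}

open Module (finrank)

lemma tendsto_prod_exceedance_translateSup_ball (μ : Measure E) [μ.IsAddHaarMeasure]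
    [IsFiniteMeasure G] (hξ : 0 < ξ) (hG : IsRegularlyVarying (tail G) (-ξ))
    (hγ : finrank ℝ E / ξ < γ) (hD₀ : 0 < D)
    (hD : ∀ x, h x ≤ ENNReal.ofReal (D * ((1 + ‖x‖) ^ γ)⁻¹)) (lam : ℝ) {r : ℝ} (hr : 1 ≤ r) :
    Tendsto (fun s : ℝ => (μ.prod (ENNReal.ofReal lam • G))
      (exceedance (translateSup h (Metric.ball 0 r)) (ENNReal.ofReal s))) atTop (𝓝 0) := by
  obtain ⟨D', hD', g, hg, hbound⟩ := exists_exceedProb_translateSup_le μ hξ hG hγ hD₀ hD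
  have hmajorant : Tendsto (fun s : ℝ => ENNReal.ofReal lam * (ENNReal.ofReal (r ^ finrank ℝ E) *
      (ENNReal.ofReal (tail G (D' * s)) * ∫⁻ u, g u ∂μ))) atTop (𝓝 0) := by
    have htail := ENNReal.tendsto_ofReal
      ((tendsto_tail_atTop (G := G)).comp (tendsto_id.const_mul_atTop hD'))
    rw [ENNReal.ofReal_zero] at htail
    simpa using ENNReal.Tendsto.const_mul (ENNReal.Tendsto.const_mul
      (ENNReal.Tendsto.mul_const htail (Or.inr hg)) (Or.inr ENNReal.ofReal_ne_top))
      (Or.inr ENNReal.ofReal_ne_top)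
  refine tendsto_of_tendsto_of_tendsto_of_le_of_le' tendsto_const_nhds hmajorant
    (.of_forall fun _ => zero_le) ?_
  filter_upwards [hbound] with s hs
  rw [prod_exceedance_translateSup μ h (one_pos.trans_le hr),
    ← lintegral_const_mul' (ENNReal.ofReal (tail G (D' * s))) g ENNReal.ofReal_ne_top]
  gcongr
  exact hs r hr _

lemma ae_markedSup_translateSup_closedBall_lt_top [IsFiniteMeasure G] (hξ : 0 < ξ)
    (hG : IsRegularlyVarying (tail G) (-ξ)) (hγ : finrank ℝ E / ξ < γ) (hD₀ : 0 < D)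
    (hD : ∀ x, h x ≤ ENNReal.ofReal (D * ((1 + ‖x‖) ^ γ)⁻¹))
    (hΦ : IsPoissonPointProcess Φ (μ.prod (ENNReal.ofReal lam • G)) P) (R : ℝ) :
    ∀ᵐ ω ∂P, markedSup (translateSup h (Metric.closedBall 0 R)) (Φ ω) < ∞ := by
  obtain ⟨r, hRr, hr⟩ : ∃ r, R < r ∧ 1 ≤ r :=
    ⟨max R 0 + 1, by linarith [le_max_left R 0], by linarith [le_max_right R 0]⟩
  have hintensity := (tendsto_prod_exceedance_translateSup_ball μ hξ hG hγ hD₀ hD lam hr).comp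
    tendsto_natCast_atTop_atTop
  filter_upwards [ae_markedSup_lt_top hΦ (measurable_translateSup h Metric.isOpen_ball)
    (fun _ => ENNReal.ofReal_ne_top) hintensity] with ω hω
  refine lt_of_le_of_lt (iSup₂_mono fun φ _ => ?_) hω
  gcongr
  exact translateSup_mono h (Metric.closedBall_subset_ball hRr) _

lemma normalising_const_rpow (hξ : 0 < ξ) (hlam : 0 < lam) {H v s : ℝ} (hH : 0 < H) (hv : 0 < v)
    (hs : 0 < s) :
    lam * ((H * v ^ (1 / ξ) * lam ^ (1 / ξ) * s) ^ (-ξ) * H ^ ξ * v) = s ^ (-ξ) := by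
  have hroot (y : ℝ) (hy : 0 < y) : (y ^ (1 / ξ)) ^ (-ξ) = y⁻¹ := by
    rw [← Real.rpow_mul hy.le, mul_neg, one_div_mul_cancel hξ.ne', Real.rpow_neg_one]
  rw [Real.mul_rpow (by positivity) hs.le, Real.mul_rpow (by positivity) (by positivity),
    Real.mul_rpow hH.le (by positivity), hroot v hv, hroot lam hlam, Real.rpow_neg hH.le]
  field_simp

lemma tendsto_measureReal_markedSup_le [IsFiniteMeasure G] (hξ : 0 < ξ)
    (hG : IsRegularlyVarying (tail G) (-ξ)) (hγ : finrank ℝ E / ξ < γ) (hD₀ : 0 < D)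
    (hD : ∀ x, h x ≤ ENNReal.ofReal (D * ((1 + ‖x‖) ^ γ)⁻¹))
    (hΦ : IsPoissonPointProcess Φ (μ.prod (ENNReal.ofReal lam • G)) P) {t : ℝ → ℝ} {κ : ℝ}
    (ht : Tendsto t atTop atTop)
    (hκ : Tendsto (fun R => R ^ finrank ℝ E * tail G (t R)) atTop (𝓝 κ)) :
    Tendsto (fun R : ℝ => P.real {ω | markedSup (translateSup h (Metric.closedBall 0 R)) (Φ ω) ≤
        ENNReal.ofReal (t R)}) atTop
      (𝓝 (Real.exp (-(ENNReal.ofReal lam * (ENNReal.ofReal κ * (⨆ x, h x) ^ ξ *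
        μ (Metric.ball 0 1))).toReal))) := by
  have hγ₀ : 0 ≤ γ := le_trans (by positivity) hγ.le
  have hlim := ENNReal.Tendsto.const_mul (a := ENNReal.ofReal lam)
    (tendsto_pow_mul_lintegral_exceedProb μ hξ hG hγ hD₀ hD ht hκ) (Or.inr ENNReal.ofReal_ne_top)
  have hfin : ENNReal.ofReal lam * (ENNReal.ofReal κ * (⨆ x, h x) ^ ξ *
      μ (Metric.ball 0 1)) ≠ ∞ :=
    ENNReal.mul_ne_top ENNReal.ofReal_ne_top (ENNReal.mul_ne_top (ENNReal.mul_ne_top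
      ENNReal.ofReal_ne_top (ENNReal.rpow_ne_top_of_nonneg hξ.le
        (iSup_ne_top_of_decay hγ₀ hD₀.le hD))) measure_ball_lt_top.ne)
  refine ((ENNReal.tendsto_toReal hfin).comp hlim).neg.rexp.congr' ?_
  filter_upwards [hlim.eventually_lt_const hfin.lt_top, eventually_gt_atTop 0] with R hRfin hR
  rw [← prod_exceedance_translateSup μ h hR] at hRfin
  simp only [Function.comp]
  rw [← prod_exceedance_translateSup μ h hR,
    ← measureReal_markedSup_le hΦ (measurable_translateSup h Metric.isOpen_ball) hRfin.ne]
  refine measureReal_congr ?_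
  filter_upwards [markedSup_ae_congr hΦ (translateSup_closedBall_ae_eq μ h hR)] with ω hω
  simp only [Set.ofPred, hω]

lemma tendsto_measureReal_markedSup_div_le [IsProbabilityMeasure G] [Nontrivial E] (hξ : 0 < ξ)
    (hlam : 0 < lam) (hG : IsRegularlyVarying (tail G) (-ξ)) (hne : ∃ x, h x ≠ 0)
    (hγ : finrank ℝ E / ξ < γ) (hD₀ : 0 < D)
    (hD : ∀ x, h x ≤ ENNReal.ofReal (D * ((1 + ‖x‖) ^ γ)⁻¹))
    (hΦ : IsPoissonPointProcess Φ (μ.prod (ENNReal.ofReal lam • G)) P) {s : ℝ} (hs : 0 < s) :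
    Tendsto (fun R : ℝ => P.real {ω |
        (markedSup (translateSup h (Metric.closedBall 0 R)) (Φ ω)).toReal /
          ((⨆ x, h x).toReal * μ.real (Metric.ball 0 1) ^ (1 / ξ) * lam ^ (1 / ξ) *
            quantile G (1 - (R ^ finrank ℝ E)⁻¹)) ≤ s}) atTop
      (𝓝 (Real.exp (-s ^ (-ξ)))) := by
  have hγ₀ : 0 ≤ γ := le_trans (by positivity) hγ.le
  have hsup : (⨆ x, h x) ≠ ∞ := iSup_ne_top_of_decay hγ₀ hD₀.le hD
  have hH : 0 < (⨆ x, h x).toReal := by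
    obtain ⟨x, hx⟩ := hne
    exact ENNReal.toReal_pos (ne_bot_of_le_ne_bot hx (le_iSup h x)) hsup
  have hv : 0 < μ.real (Metric.ball (0 : E) 1) :=
    ENNReal.toReal_pos (Metric.measure_ball_pos _ _ one_pos).ne' measure_ball_lt_top.ne
  set H := (⨆ x, h x).toReal
  set v := μ.real (Metric.ball (0 : E) 1)
  have hc : 0 < H * v ^ (1 / ξ) * lam ^ (1 / ξ) * s := by positivity
  have hn : finrank ℝ E ≠ 0 := Module.finrank_pos.ne'
  have hq := tendsto_quantile_one_sub_inv_pow hG hn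
  have hlim := tendsto_measureReal_markedSup_le hξ hG hγ hD₀ hD hΦ (hq.const_mul_atTop hc)
    (tendsto_pow_mul_tail_quantile hG hn hc)
  rw [ENNReal.toReal_mul, ENNReal.toReal_mul, ENNReal.toReal_mul, ← ENNReal.toReal_rpow,
    ENNReal.toReal_ofReal hlam.le, ENNReal.toReal_ofReal (by positivity), ← measureReal_def,
    normalising_const_rpow hξ hlam hH hv hs] at hlim
  refine hlim.congr' ?_
  filter_upwards [hq.eventually_gt_atTop 0] with R hqR
  refine measureReal_congr ?_
  filter_upwards [ae_markedSup_translateSup_closedBall_lt_top hξ hG hγ hD₀ hD hΦ R] with ω hω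
  refine propext ?_
  change _ ≤ _ ↔ _ / _ ≤ _
  rw [div_le_iff₀ (by positivity), ENNReal.le_ofReal_iff_toReal_le hω.ne (by positivity)]
  ring_nf

end FrechetLimit

end ShotNoise

open ShotNoise in
theorem theorem3p4_general {E : Type*} [NormedAddCommGroup E] [NormedSpace ℝ E]
    [FiniteDimensional ℝ E] [Nontrivial E] [MeasurableSpace E] [BorelSpace E] (μ : Measure E)
    [μ.IsAddHaarMeasure] {Ω : Type*} [MeasurableSpace Ω] (P : Measure Ω) [IsProbabilityMeasure P]
    {ξ : ℝ} (hξ : 0 < ξ) {lam : ℝ} (hlam : 0 < lam) (G : Measure (Set.Ioi (0 : ℝ)))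
    [IsProbabilityMeasure G] (hG : IsRegularlyVarying (tail G) (-ξ)) (h : E → ℝ≥0∞)
    (hmeas : Measurable h) (hne : ∃ x, h x ≠ 0)
    (hdecay : ∃ γ C : ℝ, Module.finrank ℝ E / ξ < γ ∧ 0 < C ∧
      ∀ x, h x ≤ ENNReal.ofReal C * min (‖x‖ₑ ^ (-γ)) 1)
    (Φ : Ω → Set (E × Set.Ioi (0 : ℝ)))
    (hΦ : IsPoissonPointProcess Φ (μ.prod (ENNReal.ofReal lam • G)) P) :
    (∀ R : ℝ, ∀ᵐ ω ∂P, (⨆ y ∈ Metric.closedBall (0 : E) R,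
      ⨆ φ ∈ Φ ω, ENNReal.ofReal (φ.2 : ℝ) * h (y - φ.1)) < ∞) ∧
    TendstoInDistribution
      (fun (R : ℝ) (ω : Ω) => (⨆ y ∈ Metric.closedBall (0 : E) R,
          ⨆ φ ∈ Φ ω, ENNReal.ofReal (φ.2 : ℝ) * h (y - φ.1)).toReal /
        ((⨆ x, h x).toReal * μ.real (Metric.ball 0 1) ^ (1 / ξ) * lam ^ (1 / ξ) *
          quantile G (1 - (R ^ Module.finrank ℝ E)⁻¹)))
      atTop (id : ℝ → ℝ) (fun _ => P) (frechetLaw ξ hξ : Measure ℝ) := by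
  obtain ⟨γ, C, hγ, hC, hCh⟩ := hdecay
  have hγ₀ : 0 ≤ γ := le_trans (by positivity) hγ.le
  have hD₀ : 0 < C * 2 ^ γ := by positivity
  have hD (x : E) : h x ≤ ENNReal.ofReal (C * 2 ^ γ * ((1 + ‖x‖) ^ γ)⁻¹) := by
    rw [mul_assoc, ENNReal.ofReal_mul hC.le]
    exact (hCh x).trans (by gcongr; exact min_enorm_rpow_neg_one_le hγ₀ x)
  simp only [iSup_shotNoise_eq_markedSup]
  have hae (R : ℝ) := (aemeasurable_markedSup_translateSup_closedBall μ hmeas hΦ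
    R).ennreal_toReal.div_const ((⨆ x, h x).toReal * μ.real (Metric.ball 0 1) ^ (1 / ξ) *
      lam ^ (1 / ξ) * quantile G (1 - (R ^ Module.finrank ℝ E)⁻¹))
  refine ⟨ae_markedSup_translateSup_closedBall_lt_top hξ hG hγ hD₀ hD hΦ,
    tendstoInDistribution_id_of_forall_pos hae ?_ fun s hs => ?_⟩
  · rw [frechetLaw_real_Iic, frechetFun, if_neg (lt_irrefl 0)]
  · rw [frechetLaw_real_Iic, frechetFun, if_pos hs]
    exact tendsto_measureReal_markedSup_div_le hξ hlam hG hne hγ hD₀ hD hΦ hs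

theorem theorem3p4 {Ω : Type*} [MeasurableSpace Ω] (P : Measure Ω) [IsProbabilityMeasure P]
    (d : ℕ) (hd : 0 < d) (ξ : ℝ) (hξ : 0 < ξ) (lam : ℝ) (hlam : 0 < lam)
    (G : Measure (Set.Ioi (0 : ℝ))) [IsProbabilityMeasure G]
    (hG : ShotNoise.IsRegularlyVarying (ShotNoise.tail G) (-ξ))
    (h : EuclideanSpace ℝ (Fin d) → ℝ≥0∞) (hmeas : Measurable h) (hne : ∃ x, h x ≠ 0)
    (hdecay : ShotNoise.DecayCondition ξ h)
    (Φ : Ω → Set (EuclideanSpace ℝ (Fin d) × Set.Ioi (0 : ℝ)))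
    (hΦ : ShotNoise.IsPoissonPointProcess Φ
      ((volume : Measure (EuclideanSpace ℝ (Fin d))).prod (ENNReal.ofReal lam • G)) P) :
    (∀ R : ℝ, ∀ᵐ ω ∂P,
      (⨆ y ∈ Metric.closedBall (0 : EuclideanSpace ℝ (Fin d)) R,
        ShotNoise.extremalShotNoise h (Φ ω) y) < ∞) ∧
    TendstoInDistribution
      (fun (R : ℝ) (ω : Ω) =>
        (⨆ y ∈ Metric.closedBall (0 : EuclideanSpace ℝ (Fin d)) R,
          ShotNoise.extremalShotNoise h (Φ ω) y).toReal / ShotNoise.normalisation h G lam ξ R)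
      atTop (id : ℝ → ℝ) (fun _ => P) (ShotNoise.frechetLaw ξ hξ : Measure ℝ) := by
  have := Fin.pos_iff_nonempty.1 hd
  have hgeneral := theorem3p4_general volume P hξ hlam G hG h hmeas hne
    (by simpa only [finrank_euclideanSpace_fin, ShotNoise.DecayCondition] using hdecay) Φ hΦ
  simpa only [finrank_euclideanSpace_fin, ShotNoise.extremalShotNoise,
    ShotNoise.normalisation] using hgeneral
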